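/- Let $K$ be a field, let $n\ge 1$, and let $Q$ be the oriented cycle with vertex set $\mathbb Z/n$ and exactly one arrow $i\to i+1$ for each $i$. Let $A\cong KQ/I$ be a cyclic Nakayama algebra with $n$ simple modules, i.e. $I$ is an admissible ideal of the path algebra $KQ$. Its Kupisch series is the list $[c_0,c_1,\dots,c_{n-1}]$, $c_i=\dim_K e_iA$ (where $e_i$ is the trivial path at $i$, and paths are composed from left to right); it is considered up to cyclic shift. Suppose that $A$ is quasi-hereditary, i.e. there is a chain $0=I_0\subset I_1\subset\dots\subset I_m=A$ of two-sided ideals such that each $H=I_{k+1}/I_k$ is a heredity ideal of $B=A/I_k$, meaning that $H^2=H$, $H\,\mathrm{rad}(B)\,H=0$ and $H$ is projective as a right $B$-module. Then $$\operatorname{gldim}(A)=n\iff \text{the Kupisch series of }A\text{ is, up to cyclic shift, }[\underbrace{2,2,\dots,2}_{n-1},3].$$ If the Kupisch series of $A$ is not of this form, then $\operatorname{gldim}(A)\le n-1$. Here $\operatorname{gldim}(A)$ is the supremum of the projective dimensions of the finitely generated right $A$-modules. -/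

import Mathlib

universe u v w

/-- The path algebra `K Q` of a quiver `Q` with vertex set `V`: the `K`-vector space whose basis is
the set of all paths `⟨i, j, p⟩` (where `p` is a path from `i` to `j`, including the trivial paths). -/
def PathAlgebra (K : Type u) (V : Type v) [Quiver.{w} V] [Field K] : Type _ :=
  (Σ i j : V, Quiver.Path i j) →₀ K

namespace PathAlgebra

variable {K : Type u} {V : Type v} [Quiver.{w} V]

noncomputable instance [Field K] : AddCommGroup (PathAlgebra K V) :=
  inferInstanceAs (AddCommGroup ((Σ i j : V, Quiver.Path i j) →₀ K))

noncomputable instance [Field K] : Module K (PathAlgebra K V) :=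
  inferInstanceAs (Module K ((Σ i j : V, Quiver.Path i j) →₀ K))

/-- The basis element of the path algebra given by a path. -/
noncomputable def ofPath (K : Type u) [Field K] {i j : V} (p : Quiver.Path i j) :
    PathAlgebra K V :=
  Finsupp.single (⟨i, j, p⟩ : Σ i j : V, Quiver.Path i j) (1 : K)

/-- The trivial path `e_i` at the vertex `i`. -/
noncomputable def idem (K : Type u) [Field K] (i : V) : PathAlgebra K V :=
  ofPath K (Quiver.Path.nil : Quiver.Path i i)

open Classical in
/-- The product of two paths in the path algebra: the concatenation "first `p`, then `q`" if `q`
starts where `p` ends, and zero otherwise. -/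
noncomputable def pathMul (K : Type u) [Field K] (p q : Σ i j : V, Quiver.Path i j) :
    PathAlgebra K V :=
  if h : p.2.1 = q.1 then ofPath K (p.2.2.comp (q.2.2.cast h.symm rfl)) else 0

theorem pathMul_comp (K : Type u) [Field K] {i j k : V} (p : Quiver.Path i j)
    (q : Quiver.Path j k) :
    pathMul K ⟨i, j, p⟩ ⟨j, k, q⟩ = ofPath K (p.comp q) := by
  simp [pathMul]

theorem pathMul_of_ne (K : Type u) [Field K] {i j k l : V} (p : Quiver.Path i j)
    (q : Quiver.Path k l) (h : j ≠ k) :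
    pathMul K ⟨i, j, p⟩ ⟨k, l, q⟩ = 0 := by
  simp [pathMul, h]

variable [Field K]

/-- The bilinear extension of the product of paths. -/
noncomputable def mulHom (K : Type u) (V : Type v) [Quiver.{w} V] [Field K] :
    PathAlgebra K V →ₗ[K] PathAlgebra K V →ₗ[K] PathAlgebra K V :=
  Finsupp.linearCombination K fun p : Σ i j : V, Quiver.Path i j =>
    (Finsupp.linearCombination K fun q : Σ i j : V, Quiver.Path i j => pathMul K p q :
      ((Σ i j : V, Quiver.Path i j) →₀ K) →ₗ[K] PathAlgebra K V)

theorem mulHom_ofPath {i j k l : V} (p : Quiver.Path i j) (q : Quiver.Path k l) :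
    mulHom K V (ofPath K p) (ofPath K q) = pathMul K ⟨i, j, p⟩ ⟨k, l, q⟩ := by
  have h₁ := Finsupp.linearCombination_single K (1 : K) (⟨i, j, p⟩ : Σ i j : V, Quiver.Path i j)
    (v := fun p : Σ i j : V, Quiver.Path i j =>
      (Finsupp.linearCombination K fun q : Σ i j : V, Quiver.Path i j => pathMul K p q :
        ((Σ i j : V, Quiver.Path i j) →₀ K) →ₗ[K] PathAlgebra K V))
  have h₂ := Finsupp.linearCombination_single K (1 : K) (⟨k, l, q⟩ : Σ i j : V, Quiver.Path i j)
    (v := fun q => pathMul K ⟨i, j, p⟩ q)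
  rw [one_smul] at h₁ h₂
  exact (congrArg (fun f => f (ofPath K q)) h₁).trans h₂

theorem hom_ext {M : Type*} [AddCommMonoid M] [Module K M] {f g : PathAlgebra K V →ₗ[K] M}
    (h : ∀ (i j : V) (p : Quiver.Path i j), f (ofPath K p) = g (ofPath K p)) : f = g := by
  refine Finsupp.lhom_ext' fun p => LinearMap.ext_ring ?_
  exact h p.1 p.2.1 p.2.2

noncomputable instance : Mul (PathAlgebra K V) := ⟨fun x y => mulHom K V x y⟩

theorem mul_def (x y : PathAlgebra K V) : x * y = mulHom K V x y := rfl

theorem ofPath_mul_ofPath {i j k : V} (p : Quiver.Path i j) (q : Quiver.Path j k) :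
    ofPath K p * ofPath K q = ofPath K (p.comp q) := by
  rw [mul_def, mulHom_ofPath, pathMul_comp]

theorem ofPath_mul_ofPath_of_ne {i j k l : V} (p : Quiver.Path i j) (q : Quiver.Path k l)
    (h : j ≠ k) : ofPath K p * ofPath K q = 0 := by
  rw [mul_def, mulHom_ofPath, pathMul_of_ne _ _ _ h]

theorem ofPath_mul_assoc {i j k l m n : V} (p : Quiver.Path i j) (q : Quiver.Path k l)
    (r : Quiver.Path m n) :
    ofPath K p * ofPath K q * ofPath K r = ofPath K p * (ofPath K q * ofPath K r) := by
  by_cases h : j = k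
  · subst h
    by_cases h' : l = m
    · subst h'
      simp only [ofPath_mul_ofPath, Quiver.Path.comp_assoc]
    · rw [ofPath_mul_ofPath, ofPath_mul_ofPath_of_ne _ _ h', ofPath_mul_ofPath_of_ne _ _ h']
      simp [mul_def]
  · rw [ofPath_mul_ofPath_of_ne _ _ h]
    by_cases h' : l = m
    · subst h'
      rw [ofPath_mul_ofPath, ofPath_mul_ofPath_of_ne _ _ h]
      simp [mul_def]
    · rw [ofPath_mul_ofPath_of_ne _ _ h']
      simp [mul_def]

theorem add_mul' (x y z : PathAlgebra K V) : (x + y) * z = x * z + y * z := by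
  simp only [mul_def, map_add, LinearMap.add_apply]

theorem mul_add' (x y z : PathAlgebra K V) : x * (y + z) = x * y + x * z := by
  simp only [mul_def, map_add]

theorem smul_mul' (r : K) (x y : PathAlgebra K V) : (r • x) * y = r • (x * y) := by
  simp only [mul_def, map_smul, LinearMap.smul_apply]

theorem mul_smul' (r : K) (x y : PathAlgebra K V) : x * (r • y) = r • (x * y) := by
  simp only [mul_def, map_smul]

theorem mul_assoc' (x y z : PathAlgebra K V) : x * y * z = x * (y * z) := by
  let F : PathAlgebra K V →ₗ[K] PathAlgebra K V →ₗ[K] PathAlgebra K V →ₗ[K] PathAlgebra K V :=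
    (LinearMap.llcomp K (PathAlgebra K V) (PathAlgebra K V) _ (mulHom K V)) ∘ₗ mulHom K V
  let G : PathAlgebra K V →ₗ[K] PathAlgebra K V →ₗ[K] PathAlgebra K V →ₗ[K] PathAlgebra K V :=
    LinearMap.lcomp K _ (mulHom K V) ∘ₗ
      (LinearMap.llcomp K (PathAlgebra K V) (PathAlgebra K V) (PathAlgebra K V)) ∘ₗ mulHom K V
  have h : F = G :=
    hom_ext fun i j p => hom_ext fun k l q => hom_ext fun m n r => ofPath_mul_assoc p q r
  exact congrArg (fun H => H x y z) h

variable [Fintype V]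

noncomputable instance : One (PathAlgebra K V) := ⟨∑ i : V, idem K i⟩

theorem one_def : (1 : PathAlgebra K V) = ∑ i : V, idem K i := rfl

theorem one_mul' (x : PathAlgebra K V) : 1 * x = x := by
  have h : mulHom K V 1 = LinearMap.id := by
    refine hom_ext fun i j p => ?_
    rw [one_def, map_sum, LinearMap.sum_apply, Finset.sum_eq_single i]
    · exact (ofPath_mul_ofPath Quiver.Path.nil p).trans (by rw [Quiver.Path.nil_comp]; rfl)
    · intro k _ hk
      exact ofPath_mul_ofPath_of_ne _ _ hk
    · simp
  exact congrArg (fun H => H x) h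

theorem mul_one' (x : PathAlgebra K V) : x * 1 = x := by
  have h : (mulHom K V).flip 1 = LinearMap.id := by
    refine hom_ext fun i j p => ?_
    rw [LinearMap.flip_apply, one_def, map_sum, Finset.sum_eq_single j]
    · exact ofPath_mul_ofPath p Quiver.Path.nil
    · intro k _ hk
      exact ofPath_mul_ofPath_of_ne _ _ hk.symm
    · simp
  exact congrArg (fun H => H x) h

noncomputable instance : Ring (PathAlgebra K V) :=
  { (inferInstance : AddCommGroup (PathAlgebra K V)) with
    mul := fun x y => x * y
    one := 1
    left_distrib := mul_add'
    right_distrib := add_mul'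
    zero_mul := fun x => by
      change mulHom K V 0 x = 0
      simp only [map_zero, LinearMap.zero_apply]
    mul_zero := fun x => by
      change mulHom K V x 0 = 0
      simp only [map_zero]
    mul_assoc := mul_assoc'
    one_mul := one_mul'
    mul_one := mul_one' }

noncomputable instance : Algebra K (PathAlgebra K V) :=
  Algebra.ofModule smul_mul' mul_smul'

/-- The `m`-th power of the arrow ideal, i.e. the span of all paths of length at least `m`. -/
noncomputable def arrowIdealPow (K : Type u) (V : Type v) [Quiver.{w} V] [Field K] (m : ℕ) :
    Submodule K (PathAlgebra K V) :=
  Submodule.span K {x | ∃ (i j : V) (p : Quiver.Path i j), m ≤ p.length ∧ x = ofPath K p}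

end PathAlgebra

/-- `φ : K Q → A` presents `A` as a bound quiver algebra: `φ` is surjective and its kernel is an
admissible ideal, so that `A ≅ K Q / I` with `I` admissible. -/
structure IsBoundQuiverPresentation {K : Type*} {V : Type*} [Quiver V] [Fintype V] [Field K]
    {A : Type*} [Ring A] [Algebra K A] (φ : PathAlgebra K V →ₐ[K] A) : Prop where
  surjective : Function.Surjective φ
  exists_arrowIdealPow_le :
    ∃ N : ℕ, 2 ≤ N ∧ PathAlgebra.arrowIdealPow K V N ≤ LinearMap.ker φ.toLinearMap
  le_arrowIdealPow_two : LinearMap.ker φ.toLinearMap ≤ PathAlgebra.arrowIdealPow K V 2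

/-- The vertices `0, …, n - 1` of the oriented cycle, regarded as integers modulo `n`. -/
def CyclicQuiver (n : ℕ) : Type := ZMod n

/-- There is exactly one arrow `i → i + 1` for every vertex `i` and there are no other arrows. -/
instance (n : ℕ) : Quiver (CyclicQuiver n) where
  Hom (i j : ZMod n) := PLift (j = i + 1)

instance (n : ℕ) [NeZero n] : Fintype (CyclicQuiver n) := inferInstanceAs (Fintype (ZMod n))

/-- The Kupisch series `[c_0, …, c_{n-1}]` of a Nakayama algebra `A` presented by the oriented cycle
with `n` vertices: `c_i` is the `K`-dimension of the projective right module `e_i A`. -/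
noncomputable def kupischSeries {K : Type*} [Field K] {n : ℕ} [NeZero n] {A : Type*} [Ring A]
    [Algebra K A] (φ : PathAlgebra K (CyclicQuiver n) →ₐ[K] A) : List ℕ :=
  List.ofFn fun i : Fin n =>
    Module.finrank K (LinearMap.range
      (LinearMap.mulLeft K (φ (PathAlgebra.idem K (((i : ℕ) : ZMod n) : CyclicQuiver n)))))

/-- The global dimension of a ring `A` : the supremum of the projective dimensions of the finitely
generated right `A`-modules (right `A`-modules are modules over the opposite ring). -/
noncomputable def globalDimension (A : Type u) [Ring A] : WithBot ℕ∞ :=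
  ⨆ (M : ModuleCat.{u} Aᵐᵒᵖ) (_ : Module.Finite Aᵐᵒᵖ M), CategoryTheory.projectiveDimension M

/-- A two-sided ideal `I` of `A` is a heredity ideal if `I² = I`, `I J I = 0` for the Jacobson radical
`J` of `A`, and `I` is projective as a right `A`-module. -/
structure IsHeredityIdeal {A : Type*} [Ring A] (I : TwoSidedIdeal A) : Prop where
  idempotent : I.asIdeal * I.asIdeal = I.asIdeal
  mul_jacobson_mul : ∀ x ∈ I, ∀ j ∈ Ring.jacobson A, ∀ y ∈ I, x * j * y = 0
  projective : Module.Projective Aᵐᵒᵖ I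

/-- A ring `A` is quasi-hereditary if it has a heredity chain, i.e. a chain
`0 = I_0 < I_1 < ⋯ < I_m = A` of two-sided ideals such that `I_{k+1} / I_k` is a heredity ideal
of `A / I_k` for all `k < m`. -/
def IsQuasiHereditary (A : Type*) [Ring A] : Prop :=
  ∃ (m : ℕ) (I : Fin (m + 1) → TwoSidedIdeal A), StrictMono I ∧ I 0 = ⊥ ∧ I (Fin.last m) = ⊤ ∧
    ∀ k : Fin m, IsHeredityIdeal ((I k.succ).map (I k.castSucc).ringCon.mk')

/-!
Let `X` be the sum of all arrows. The module `e_i A` is uniserial with submodules `e_i X ^ l A`, and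
left multiplication by `e_i X ^ l` is a projective cover `e_{i + l} A → e_i X ^ l A` with kernel
`e_{i + l} X ^ (c_i - l) A`. So `Ω (e_i X ^ l A) = e_{i + l} X ^ (c_i - l) A`, and the global
dimension can be read off from the modules `e_i X A = rad (e_i A)`.

A nonzero heredity ideal contains some `e_i`, and each `e_k A` which reaches the vertex `i` must end
in a copy of `e_i A`. If `k + d = i`, a submodule `e_k X ^ l A` with `1 ≤ l ≤ d` is therefore zero,
or projective, or its first syzygy is a submodule of the same kind of some `e_{k'} A` with `k'`
strictly closer to `i`. Hence `rad (e_k A)` has projective dimension less than `d ≤ n`, which gives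
`gldim A ≤ n`. An entry `c_k ≥ 3` with `d ≥ 2` lets the syzygies skip a vertex and saves one step,
so `gldim A = n` forces every entry except `c_{i - 1}` to be `2`, and then `c_{i - 1} = 3`.
Conversely, if the only entry different from `2` is `c_b = 3`, then
`Ω (rad (e_k A)) = rad (e_{k + 1} A)` for `k ≠ b`. In the chain
`rad (e_{b + 1} A), …, rad (e_{b - 1} A), rad (e_b A)` of syzygies only the last module is
projective, so the first has projective dimension `n - 1`.
-/

section Ring

variable {A : Type*} [Ring A]

theorem mem_jacobson_of_forall_isNilpotent_mul {x : A} (hx : ∀ y, IsNilpotent (y * x)) :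
    x ∈ Ring.jacobson A := by
  rw [← Ideal.jacobson_bot, Ideal.mem_jacobson_iff]
  intro y
  obtain ⟨u, hu⟩ := (hx y).isUnit_add_one
  refine ⟨(u⁻¹ : Aˣ), ?_⟩
  rw [mul_assoc, ← mul_add_one, ← hu, u.inv_mul, sub_self]
  exact Submodule.zero_mem _

theorem isNilpotent_mul_of_forall_exists_mul_eq {x : A} (hx : IsNilpotent x)
    (hcomm : ∀ y, ∃ z, y * x = x * z) (y : A) : IsNilpotent (x * y) := by
  have exists_pow_eq (k : ℕ) : ∃ z, (x * y) ^ k = x ^ k * z := by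
    induction k with
    | zero => exact ⟨1, by simp⟩
    | succ k ih =>
      obtain ⟨z, hz⟩ := ih
      obtain ⟨z', hz'⟩ := hcomm z
      exact ⟨z' * y, by rw [pow_succ, hz, pow_succ, mul_assoc, ← mul_assoc z, hz']; noncomm_ring⟩
  obtain ⟨N, hN⟩ := hx
  obtain ⟨z, hz⟩ := exists_pow_eq N
  exact ⟨N, by rw [hz, hN, zero_mul]⟩

theorem mul_unit_mem_iff {N : Submodule Aᵐᵒᵖ A} {y : A} (v : Aˣ) : y * v ∈ N ↔ y ∈ N :=
  N.smul_mem_iff_of_isUnit v.isUnit.op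

theorem projective_rightRegular : Module.Projective Aᵐᵒᵖ A :=
  .of_equiv
    { toFun := MulOpposite.unop
      invFun := MulOpposite.op
      map_add' := fun _ _ => rfl
      map_smul' := fun _ _ => rfl : Aᵐᵒᵖ ≃ₗ[Aᵐᵒᵖ] A }

end Ring

theorem projective_map_of_isIdempotentElem {R M : Type*} [Ring R] [AddCommGroup M] [Module R M]
    {f : Module.End R M} (hf : IsIdempotentElem f) {N : Submodule R M} [Module.Projective R N]
    (hN : N.map f ≤ N) : Module.Projective R (N.map f) := by
  refine .of_split (Submodule.inclusion hN) (f.submoduleMap N) (LinearMap.ext ?_)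
  rintro ⟨_, y, -, rfl⟩
  exact Subtype.ext (DFunLike.congr_fun hf y)

open Polynomial in
theorem exists_eq_X_pow_mul_and_not_X_dvd {K : Type*} [Field K] {p : K[X]} (hp : p ≠ 0) :
    ∃ (r : ℕ) (q : K[X]), p = X ^ r * q ∧ ¬ X ∣ q := by
  obtain ⟨q, hq, hXq⟩ := exists_eq_pow_rootMultiplicity_mul_and_not_dvd p hp 0
  rw [map_zero, sub_zero] at hq hXq
  exact ⟨_, q, hq, hXq⟩

/-- Orthogonal idempotents `e i` with sum `1`, indexed by `ZMod n`, together with a nilpotent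
element `X` such that `e i * X = X * e (i + 1) ≠ 0` and the elements `e i * X ^ l` span `A`. In a
cyclic Nakayama algebra these are the trivial paths and the sum of all arrows. -/
structure IsCyclicFrame (K : Type*) [Field K] {n : ℕ} [NeZero n] {A : Type*} [Ring A]
    [Algebra K A] (e : ZMod n → A) (X : A) : Prop extends CompleteOrthogonalIdempotents e where
  idem_mul_X (i : ZMod n) : e i * X = X * e (i + 1)
  isNilpotent : IsNilpotent X
  mem_span (a : A) : a ∈ Submodule.span K (Set.range fun p : ZMod n × ℕ => e p.1 * X ^ p.2)
  idem_mul_X_ne_zero (i : ZMod n) : e i * X ≠ 0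

/-- The least `l` with `e i * X ^ l = 0`, which is the entry `c_i = dim (e_i A)` of the Kupisch
series. -/
noncomputable def kupischNumber {n : ℕ} {A : Type*} [Ring A] (e : ZMod n → A) (X : A)
    (i : ZMod n) : ℕ :=
  sInf {l : ℕ | e i * X ^ l = 0}

namespace IsCyclicFrame

variable {K : Type*} [Field K] {n : ℕ} [NeZero n] {A : Type*} [Ring A] [Algebra K A]
  {e : ZMod n → A} {X : A}

theorem idem_mul_pow (h : IsCyclicFrame K e X) (i : ZMod n) (l : ℕ) :
    e i * X ^ l = X ^ l * e (i + l) := by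
  induction l with
  | zero => simp
  | succ l ih =>
    rw [pow_succ, ← mul_assoc, ih, mul_assoc, h.idem_mul_X, mul_assoc, Nat.cast_succ, add_assoc]

theorem idem_mul_pow_mul_idem (h : IsCyclicFrame K e X) (i : ZMod n) (l : ℕ) :
    e i * X ^ l * e (i + l) = e i * X ^ l := by
  rw [h.idem_mul_pow, mul_assoc, h.idem]

theorem exists_mul_X_eq (h : IsCyclicFrame K e X) (y : A) : ∃ z, y * X = X * z := by
  induction h.mem_span y using Submodule.span_induction with
  | mem y hy =>
    obtain ⟨⟨i, l⟩, rfl⟩ := hy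
    exact ⟨e (i + 1) * X ^ l, by
      rw [mul_assoc, ← pow_succ, pow_succ', ← mul_assoc, h.idem_mul_X, mul_assoc]⟩
  | zero => exact ⟨0, by simp⟩
  | add y y' _ _ hy hy' =>
    obtain ⟨z, hz⟩ := hy
    obtain ⟨z', hz'⟩ := hy'
    exact ⟨z + z', by rw [add_mul, hz, hz', mul_add]⟩
  | smul a y _ hy =>
    obtain ⟨z, hz⟩ := hy
    exact ⟨a • z, by rw [smul_mul_assoc, hz, mul_smul_comm]⟩

theorem isNilpotent_X_mul (h : IsCyclicFrame K e X) (y : A) : IsNilpotent (X * y) :=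
  isNilpotent_mul_of_forall_exists_mul_eq h.isNilpotent h.exists_mul_X_eq y

theorem X_mem_jacobson (h : IsCyclicFrame K e X) : X ∈ Ring.jacobson A := by
  refine mem_jacobson_of_forall_isNilpotent_mul fun y => ?_
  obtain ⟨z, hz⟩ := h.exists_mul_X_eq y
  exact hz ▸ h.isNilpotent_X_mul z

theorem idem_mul_pow_eq_zero_iff (h : IsCyclicFrame K e X) {i : ZMod n} {l : ℕ} :
    e i * X ^ l = 0 ↔ kupischNumber e X i ≤ l := by
  have nonempty : {l : ℕ | e i * X ^ l = 0}.Nonempty := by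
    obtain ⟨N, hN⟩ := h.isNilpotent
    exact ⟨N, (congrArg (e i * ·) hN).trans (mul_zero _)⟩
  have vanishing : e i * X ^ kupischNumber e X i = 0 := Nat.sInf_mem nonempty
  refine ⟨fun hl => Nat.sInf_le hl, fun hl => ?_⟩
  rw [← Nat.add_sub_cancel' hl, pow_add, ← mul_assoc, vanishing, zero_mul]

theorem two_le_kupischNumber (h : IsCyclicFrame K e X) (i : ZMod n) : 2 ≤ kupischNumber e X i := by
  by_contra! hlt
  refine h.idem_mul_X_ne_zero i ?_
  rw [← pow_one X]
  exact h.idem_mul_pow_eq_zero_iff.2 (by omega)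

theorem kupischNumber_le_add (h : IsCyclicFrame K e X) (i : ZMod n) (l : ℕ) :
    kupischNumber e X i ≤ l + kupischNumber e X (i + l) := by
  rw [← h.idem_mul_pow_eq_zero_iff, pow_add, ← mul_assoc, h.idem_mul_pow, mul_assoc,
    h.idem_mul_pow_eq_zero_iff.2 le_rfl, mul_zero]

theorem exists_idem_mul_ne_zero (h : IsCyclicFrame K e X) {y : A} (hy : y ≠ 0) :
    ∃ i, e i * y ≠ 0 := by
  by_contra! hzero
  refine hy ?_
  rw [← one_mul y, ← h.complete, Finset.sum_mul, Finset.sum_eq_zero fun i _ => hzero i]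

theorem nontrivial (h : IsCyclicFrame K e X) : Nontrivial A :=
  ⟨_, _, h.idem_mul_X_ne_zero 0⟩

theorem moduleFinite (h : IsCyclicFrame K e X) : Module.Finite K A := by
  obtain ⟨N, hN⟩ := h.isNilpotent
  have finite : (Set.range fun p : ZMod n × Fin N => e p.1 * X ^ (p.2 : ℕ)).Finite :=
    Set.finite_range _
  refine ⟨Submodule.fg_def.2 ⟨_, finite, eq_top_iff.2 fun a _ => ?_⟩⟩
  refine Submodule.span_le.2 ?_ (h.mem_span a)
  rintro _ ⟨⟨i, l⟩, rfl⟩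
  rcases lt_or_ge l N with hl | hl
  · exact Submodule.subset_span ⟨(i, ⟨l, hl⟩), rfl⟩
  · simp only [pow_eq_zero_of_le hl hN, mul_zero, SetLike.mem_coe, Submodule.zero_mem]

section Polynomial

open Polynomial (aeval)

theorem exists_idem_mul_eq_aeval (h : IsCyclicFrame K e X) (i : ZMod n) (y : A) :
    ∃ p : Polynomial K, e i * y = e i * aeval X p := by
  induction h.mem_span y using Submodule.span_induction with
  | mem y hy =>
    obtain ⟨⟨j, l⟩, rfl⟩ := hy
    by_cases hij : i = j
    · subst hij
      exact ⟨.X ^ l, by rw [← mul_assoc, h.idem, map_pow, Polynomial.aeval_X]⟩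
    · exact ⟨0, by rw [← mul_assoc, h.ortho hij, zero_mul, map_zero, mul_zero]⟩
  | zero => exact ⟨0, by simp⟩
  | add y y' _ _ hy hy' =>
    obtain ⟨p, hp⟩ := hy
    obtain ⟨q, hq⟩ := hy'
    exact ⟨p + q, by rw [mul_add, hp, hq, map_add, mul_add]⟩
  | smul a y _ hy =>
    obtain ⟨p, hp⟩ := hy
    exact ⟨a • p, by rw [mul_smul_comm, hp, map_smul, mul_smul_comm]⟩

theorem isUnit_aeval (h : IsCyclicFrame K e X) {q : Polynomial K} (hq : ¬ Polynomial.X ∣ q) :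
    IsUnit (aeval X q) := by
  rw [Polynomial.X_dvd_iff] at hq
  rw [← Polynomial.X_mul_divX_add q, map_add, map_mul, Polynomial.aeval_X, Polynomial.aeval_C]
  exact (h.isNilpotent_X_mul _).isUnit_add_right_of_commute ((IsUnit.mk0 _ hq).map _)
    (Algebra.commutes _ _).symm

theorem exists_idem_mul_eq_pow_mul_unit (h : IsCyclicFrame K e X) (i : ZMod n) (y : A) :
    ∃ (l : ℕ) (v : Aˣ), e i * y = e i * X ^ l * v := by
  obtain ⟨p, hp⟩ := h.exists_idem_mul_eq_aeval i y
  rcases eq_or_ne p 0 with rfl | hp0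
  · obtain ⟨N, hN⟩ := h.isNilpotent
    exact ⟨N, 1, by rw [hp, hN, map_zero, mul_zero, zero_mul]⟩
  · obtain ⟨r, q, rfl, hq⟩ := exists_eq_X_pow_mul_and_not_X_dvd hp0
    obtain ⟨v, hv⟩ := h.isUnit_aeval hq
    exact ⟨r, v, by rw [hp, map_mul, map_pow, Polynomial.aeval_X, hv, mul_assoc]⟩

theorem idem_mul_aeval_eq_zero_iff (h : IsCyclicFrame K e X) {i : ZMod n} {p : Polynomial K} :
    e i * aeval X p = 0 ↔ Polynomial.X ^ kupischNumber e X i ∣ p := by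
  constructor
  · intro hp
    rcases eq_or_ne p 0 with rfl | hp0
    · exact dvd_zero _
    obtain ⟨r, q, rfl, hq⟩ := exists_eq_X_pow_mul_and_not_X_dvd hp0
    rw [map_mul, map_pow, Polynomial.aeval_X, ← mul_assoc, (h.isUnit_aeval hq).mul_left_eq_zero,
      h.idem_mul_pow_eq_zero_iff] at hp
    exact (pow_dvd_pow _ hp).mul_right _
  · rintro ⟨q, rfl⟩
    rw [map_mul, map_pow, Polynomial.aeval_X, ← mul_assoc, h.idem_mul_pow_eq_zero_iff.2 le_rfl,
      zero_mul]

theorem finrank_range_mulLeft (h : IsCyclicFrame K e X) (i : ZMod n) :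
    Module.finrank K (LinearMap.range (LinearMap.mulLeft K (e i))) = kupischNumber e X i := by
  let g : Polynomial K →ₗ[K] A := LinearMap.mulLeft K (e i) ∘ₗ (aeval X).toLinearMap
  have range_eq : LinearMap.range (LinearMap.mulLeft K (e i)) = LinearMap.range g := by
    refine le_antisymm ?_ (LinearMap.range_comp_le_range _ _)
    rintro _ ⟨y, rfl⟩
    obtain ⟨p, hp⟩ := h.exists_idem_mul_eq_aeval i y
    exact ⟨p, hp.symm⟩
  have ker_eq : LinearMap.ker g =
      (Ideal.span {(Polynomial.X : Polynomial K) ^ kupischNumber e X i}).restrictScalars K := by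
    ext p
    rw [LinearMap.mem_ker, Submodule.restrictScalars_mem, Ideal.mem_span_singleton]
    exact h.idem_mul_aeval_eq_zero_iff
  rw [range_eq, ← g.quotKerEquivRange.finrank_eq, (Submodule.quotEquivOfEq _ _ ker_eq).finrank_eq]
  exact finrank_quotient_span_eq_natDegree.trans (Polynomial.natDegree_X_pow _)

end Polynomial

end IsCyclicFrame

/-- The submodule `e_i X ^ l A` of the indecomposable projective right module `e_i A`. It is the
`l`-th power `rad ^ l (e_i A)` of the radical, and `e_i A` itself for `l = 0`. -/
def radPow {n : ℕ} {A : Type*} [Ring A] (e : ZMod n → A) (X : A) (i : ZMod n) (l : ℕ) :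
    Submodule Aᵐᵒᵖ A :=
  Submodule.span Aᵐᵒᵖ {e i * X ^ l}

section RadPow

variable {n : ℕ} {A : Type*} [Ring A] {e : ZMod n → A} {X : A} {i : ZMod n} {l m : ℕ} {y : A}

theorem mem_radPow : y ∈ radPow e X i l ↔ ∃ b, e i * X ^ l * b = y :=
  Submodule.mem_span_singleton.trans MulOpposite.opEquiv.symm.exists_congr_left

theorem radPow_le_iff {N : Submodule Aᵐᵒᵖ A} : radPow e X i l ≤ N ↔ e i * X ^ l ∈ N :=
  Submodule.span_singleton_le_iff_mem _ _

theorem mul_pow_mem_radPow (hlm : l ≤ m) : e i * X ^ m ∈ radPow e X i l :=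
  mem_radPow.2 ⟨X ^ (m - l), by rw [mul_assoc, ← pow_add, Nat.add_sub_cancel' hlm]⟩

theorem idem_mul_mem_radPow_zero : e i * y ∈ radPow e X i 0 :=
  mem_radPow.2 ⟨y, by rw [pow_zero, mul_one]⟩

theorem radPow_antitone (e : ZMod n → A) (X : A) (i : ZMod n) : Antitone (radPow e X i) :=
  fun _ _ hlm => radPow_le_iff.2 (mul_pow_mem_radPow hlm)

/-- Left multiplication by `e i * X ^ l`, the projective cover of `e_i X ^ l A`. -/
def radPowCover (e : ZMod n → A) (X : A) (i : ZMod n) (l : ℕ) :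
    radPow e X (i + l) 0 →ₗ[Aᵐᵒᵖ] radPow e X i l :=
  ((LinearMap.mulLeft Aᵐᵒᵖ (e i * X ^ l)).domRestrict _).codRestrict _
    fun y => mem_radPow.2 ⟨y, rfl⟩

theorem coe_radPowCover (y : radPow e X (i + l) 0) :
    (radPowCover e X i l y : A) = e i * X ^ l * y :=
  rfl

end RadPow

namespace IsCyclicFrame

section Uniserial

variable {K : Type*} [Field K] {n : ℕ} [NeZero n] {A : Type*} [Ring A] [Algebra K A]
  {e : ZMod n → A} {X : A} {i : ZMod n} {l m : ℕ} {y : A}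

theorem idem_mul_of_mem_radPow (h : IsCyclicFrame K e X) (hy : y ∈ radPow e X i l) :
    e i * y = y := by
  obtain ⟨b, rfl⟩ := mem_radPow.1 hy
  rw [← mul_assoc, ← mul_assoc, h.idem]

theorem mul_pow_mem_radPow_iff (h : IsCyclicFrame K e X) :
    e i * X ^ m ∈ radPow e X i l ↔ l ≤ m ∨ kupischNumber e X i ≤ m := by
  refine ⟨fun hm => ?_, ?_⟩
  · obtain ⟨b, hb⟩ := mem_radPow.1 hm
    by_contra! hlt
    refine hlt.2.not_ge (h.idem_mul_pow_eq_zero_iff.1 ?_)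
    have isUnit : IsUnit (1 - X * (X ^ (l - m - 1) * b)) := (h.isNilpotent_X_mul _).isUnit_one_sub
    refine isUnit.mul_left_eq_zero.1 ?_
    rw [mul_sub, mul_one, ← mul_assoc X, ← pow_succ', Nat.sub_add_cancel (by omega), ← mul_assoc,
      mul_assoc (e i), ← pow_add, Nat.add_sub_cancel' hlt.1.le, hb, sub_self]
  · rintro (hlm | hm)
    · exact mul_pow_mem_radPow hlm
    · rw [h.idem_mul_pow_eq_zero_iff.2 hm]
      exact Submodule.zero_mem _

theorem radPow_eq_bot (h : IsCyclicFrame K e X) (hl : kupischNumber e X i ≤ l) :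
    radPow e X i l = ⊥ := by
  rw [radPow, h.idem_mul_pow_eq_zero_iff.2 hl, Submodule.span_zero_singleton]

theorem mul_mem_radPow_add (h : IsCyclicFrame K e X) (hy : y ∈ radPow e X (i + l) m) :
    e i * X ^ l * y ∈ radPow e X i (l + m) := by
  obtain ⟨b, rfl⟩ := mem_radPow.1 hy
  exact mem_radPow.2 ⟨b, by
    rw [← mul_assoc, ← mul_assoc, h.idem_mul_pow_mul_idem, pow_add, mul_assoc (e i) (X ^ l)]⟩

theorem exists_eq_radPow (h : IsCyclicFrame K e X) {N : Submodule Aᵐᵒᵖ A}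
    (hN : N ≤ radPow e X i 0) : ∃ l ≤ kupischNumber e X i, N = radPow e X i l := by
  classical
  have exists_mem : ∃ l, e i * X ^ l ∈ N :=
    ⟨_, (h.idem_mul_pow_eq_zero_iff.2 le_rfl).symm ▸ N.zero_mem⟩
  refine ⟨Nat.find exists_mem, Nat.find_min' _ ?_,
    le_antisymm (fun y hy => ?_) (radPow_le_iff.2 (Nat.find_spec exists_mem))⟩
  · exact (h.idem_mul_pow_eq_zero_iff.2 le_rfl).symm ▸ N.zero_mem
  · obtain ⟨r, v, hr⟩ := h.exists_idem_mul_eq_pow_mul_unit i y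
    rw [h.idem_mul_of_mem_radPow (hN hy)] at hr
    rw [hr, mul_unit_mem_iff] at hy ⊢
    exact mul_pow_mem_radPow (Nat.find_min' _ hy)

theorem isIdempotentElem_mulLeft (h : IsCyclicFrame K e X) (i : ZMod n) :
    IsIdempotentElem (LinearMap.mulLeft Aᵐᵒᵖ (e i)) :=
  LinearMap.ext fun y => (mul_assoc _ _ y).symm.trans (congrArg (· * y) (h.idem i))

theorem projective_radPow_zero (h : IsCyclicFrame K e X) (i : ZMod n) :
    Module.Projective Aᵐᵒᵖ (radPow e X i 0) := by
  have := projective_rightRegular (A := A)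
  have : Module.Projective Aᵐᵒᵖ (⊤ : Submodule Aᵐᵒᵖ A) := .of_equiv Submodule.topEquiv.symm
  have radPow_eq : radPow e X i 0 = (⊤ : Submodule Aᵐᵒᵖ A).map (LinearMap.mulLeft Aᵐᵒᵖ (e i)) := by
    ext y
    rw [mem_radPow, pow_zero, mul_one]
    exact ⟨fun ⟨b, hb⟩ => ⟨b, trivial, hb⟩, fun ⟨b, _, hb⟩ => ⟨b, hb⟩⟩
  rw [radPow_eq]
  exact projective_map_of_isIdempotentElem (h.isIdempotentElem_mulLeft i) le_top

theorem radPowCover_surjective (h : IsCyclicFrame K e X) (i : ZMod n) (l : ℕ) :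
    Function.Surjective (radPowCover e X i l) := by
  rintro ⟨y, hy⟩
  obtain ⟨b, rfl⟩ := mem_radPow.1 hy
  refine ⟨⟨e (i + l) * b, idem_mul_mem_radPow_zero⟩, Subtype.ext ?_⟩
  rw [coe_radPowCover, ← mul_assoc, h.idem_mul_pow_mul_idem]

theorem ker_radPowCover (h : IsCyclicFrame K e X) (i : ZMod n) (l : ℕ) :
    LinearMap.ker (radPowCover e X i l) =
      (radPow e X (i + l) (kupischNumber e X i - l)).submoduleOf (radPow e X (i + l) 0) := by
  ext y
  rw [LinearMap.mem_ker, Submodule.submoduleOf, Submodule.mem_comap, Submodule.subtype_apply,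
    ← Submodule.coe_eq_zero, coe_radPowCover]
  constructor
  · intro hzero
    obtain ⟨r, v, hr⟩ := h.exists_idem_mul_eq_pow_mul_unit (i + l) y
    rw [h.idem_mul_of_mem_radPow y.2] at hr
    rw [hr, ← mul_assoc, ← mul_assoc, h.idem_mul_pow_mul_idem, v.isUnit.mul_left_eq_zero,
      mul_assoc, ← pow_add, h.idem_mul_pow_eq_zero_iff] at hzero
    rw [hr, mul_unit_mem_iff]
    exact mul_pow_mem_radPow (by omega)
  · intro hmem
    have := h.mul_mem_radPow_add hmem
    rwa [h.radPow_eq_bot (by omega), Submodule.mem_bot] at this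

theorem projective_radPow_iff (h : IsCyclicFrame K e X) (hl : l < kupischNumber e X i) :
    Module.Projective Aᵐᵒᵖ (radPow e X i l) ↔
      l + kupischNumber e X (i + l) ≤ kupischNumber e X i := by
  constructor
  · intro
    obtain ⟨s, hs⟩ := Module.projective_lifting_property (radPowCover e X i l) LinearMap.id
      (h.radPowCover_surjective i l)
    obtain ⟨r, -, hr⟩ := h.exists_eq_radPow (Submodule.map_subtype_le _ (LinearMap.range s))
    have cover_s (y) : e i * X ^ l * (s y : A) = y :=
      congrArg Subtype.val (LinearMap.congr_fun hs y)
    obtain rfl : r = 0 := by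
      have mem : (s ⟨e i * X ^ l, mul_pow_mem_radPow le_rfl⟩ : A) ∈ radPow e X (i + l) r :=
        hr ▸ ⟨_, ⟨_, rfl⟩, rfl⟩
      have := h.mul_mem_radPow_add mem
      rw [cover_s, h.mul_pow_mem_radPow_iff] at this
      omega
    obtain ⟨_, ⟨y, rfl⟩, hy⟩ := hr.ge (mul_pow_mem_radPow (kupischNumber e X i - l).zero_le)
    have hy_zero : y = 0 := by
      rw [← Submodule.coe_eq_zero, ← cover_s, ← Submodule.subtype_apply, hy, ← mul_assoc,
        h.idem_mul_pow_mul_idem, mul_assoc, ← pow_add, h.idem_mul_pow_eq_zero_iff]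
      omega
    rw [hy_zero, map_zero, map_zero, eq_comm, h.idem_mul_pow_eq_zero_iff] at hy
    omega
  · intro hle
    have := h.projective_radPow_zero (i + l)
    refine .of_equiv (.ofBijective (radPowCover e X i l)
      ⟨LinearMap.ker_eq_bot.1 ?_, h.radPowCover_surjective i l⟩)
    rw [h.ker_radPowCover, h.radPow_eq_bot (l := kupischNumber e X i - l) (by omega),
      Submodule.submoduleOf, Submodule.comap_bot, Submodule.ker_subtype]

end Uniserial

end IsCyclicFrame

open CategoryTheory in
/-- The `R`-module `M` has projective dimension less than `d`. -/
abbrev ProjDimLT (R : Type v) [Ring R] (M : Type v) [AddCommGroup M] [Module R M] (d : ℕ) : Prop :=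
  HasProjectiveDimensionLT (ModuleCat.of R M) d

namespace ProjDimLT

variable {R : Type v} [Ring R] {M : Type v} [AddCommGroup M] [Module R M]

theorem mono {d d' : ℕ} (h : d ≤ d') (_ : ProjDimLT R M d) : ProjDimLT R M d' :=
  CategoryTheory.hasProjectiveDimensionLT_of_ge _ d d' h

theorem of_subsingleton [Subsingleton M] (d : ℕ) : ProjDimLT R M d :=
  mono d.zero_le (ModuleCat.isZero_of_subsingleton _).hasProjectiveDimensionLT_zero

theorem one_iff : ProjDimLT R M 1 ↔ Module.Projective R M := by
  rw [IsProjective.iff_projective, CategoryTheory.projective_iff_hasProjectiveDimensionLT_one]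

theorem of_submodule_of_quotient {N : Submodule R M} {d : ℕ} (hN : ProjDimLT R N d)
    (hQ : ProjDimLT R (M ⧸ N) d) : ProjDimLT R M d :=
  (ModuleCat.shortComplex_shortExact
    (.mk (ModuleCat.ofHom N.subtype) (ModuleCat.ofHom N.mkQ) (by ext x; simp))
    (LinearMap.exact_subtype_mkQ N) N.injective_subtype N.mkQ_surjective
    ).hasProjectiveDimensionLT_X₂ d hN hQ

theorem of_isFiniteLength {d : ℕ}
    (hsimple : ∀ (T : Type v) [AddCommGroup T] [Module R T] [IsSimpleModule R T], ProjDimLT R T d)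
    (hM : IsFiniteLength R M) : ProjDimLT R M d := by
  induction hM with
  | of_subsingleton => exact of_subsingleton d
  | of_simple_quotient _ hN => exact of_submodule_of_quotient hN (hsimple _)

section Syzygy

variable {B : Type v} [AddCommGroup B] [Module R B] {N P : Submodule R B} [Module.Projective R P]
  {g : P →ₗ[R] M}

theorem succ_iff_of_surjective (hNP : N ≤ P) (hg : Function.Surjective g)
    (hker : LinearMap.ker g = N.submoduleOf P) {d : ℕ} (hd : d ≠ 0) :
    ProjDimLT R M (d + 1) ↔ ProjDimLT R N d := by
  have exact_inclusion : Function.Exact (Submodule.inclusion hNP) g := by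
    rw [LinearMap.exact_iff, hker, Submodule.range_inclusion, Submodule.submoduleOf]
  have shortExact := ModuleCat.shortComplex_shortExact
    (.mk (ModuleCat.ofHom (Submodule.inclusion hNP)) (ModuleCat.ofHom g)
      (by ext y; exact exact_inclusion.apply_apply_eq_zero y))
    exact_inclusion (Submodule.inclusion_injective hNP) hg
  have hP : ProjDimLT R P 1 := one_iff.2 inferInstance
  exact ⟨shortExact.hasProjectiveDimensionLT_X₁ d (hP.mono (by omega)),
    fun hN => shortExact.hasProjectiveDimensionLT_X₃ d hN (hP.mono (by omega))⟩

end Syzygy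

end ProjDimLT

namespace IsCyclicFrame

section GlobalDimension

variable {K : Type*} [Field K] {n : ℕ} [NeZero n] {A : Type v} [Ring A] [Algebra K A]
  {e : ZMod n → A} {X : A}

theorem projDimLT_succ_iff (h : IsCyclicFrame K e X) (i : ZMod n) (l : ℕ) {d : ℕ} (hd : d ≠ 0) :
    ProjDimLT Aᵐᵒᵖ (radPow e X i l) (d + 1) ↔
      ProjDimLT Aᵐᵒᵖ (radPow e X (i + l) (kupischNumber e X i - l)) d :=
  have := h.projective_radPow_zero (i + l)
  ProjDimLT.succ_iff_of_surjective (radPow_antitone e X _ (Nat.zero_le _))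
    (h.radPowCover_surjective i l) (h.ker_radPowCover i l) hd

theorem eq_radPow_one_of_isCoatom (h : IsCyclicFrame K e X) {i : ZMod n}
    {N : Submodule Aᵐᵒᵖ (radPow e X i 0)} (hN : IsCoatom N) :
    N = (radPow e X i 1).submoduleOf (radPow e X i 0) := by
  obtain ⟨l, -, hl⟩ := h.exists_eq_radPow (Submodule.map_subtype_le _ N)
  refine ((hN.le_iff_eq fun htop => ?_).1 ?_).symm
  · have mem := Submodule.comap_subtype_eq_top.1 htop (mul_pow_mem_radPow le_rfl)
    rw [h.mul_pow_mem_radPow_iff] at mem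
    have := h.two_le_kupischNumber i
    omega
  · refine Submodule.map_le_iff_le_comap.1 (hl ▸ radPow_antitone e X i ?_)
    refine Nat.one_le_iff_ne_zero.2 fun hl0 => hN.1 ?_
    exact Submodule.map_injective_of_injective (Submodule.subtype_injective _)
      (by rw [hl, hl0, Submodule.map_subtype_top])

theorem exists_surjective_of_isSimpleModule (h : IsCyclicFrame K e X) (T : Type*) [AddCommGroup T]
    [Module Aᵐᵒᵖ T] [IsSimpleModule Aᵐᵒᵖ T] :
    ∃ (i : ZMod n) (g : radPow e X i 0 →ₗ[Aᵐᵒᵖ] T), Function.Surjective g := by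
  have := IsSimpleModule.nontrivial Aᵐᵒᵖ T
  obtain ⟨t, ht⟩ := exists_ne (0 : T)
  obtain ⟨i, hi⟩ : ∃ i, MulOpposite.op (e i) • t ≠ 0 := by
    by_contra! hzero
    refine ht ?_
    rw [← one_smul Aᵐᵒᵖ t, ← MulOpposite.op_one, ← h.complete, Finset.op_sum, Finset.sum_smul]
    exact Finset.sum_eq_zero fun i _ => hzero i
  let g : radPow e X i 0 →ₗ[Aᵐᵒᵖ] T :=
    { toFun := fun y => MulOpposite.op (y : A) • t
      map_add' := fun y z => add_smul (MulOpposite.op (y : A)) (MulOpposite.op (z : A)) t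
      map_smul' := fun r y => mul_smul r (MulOpposite.op (y : A)) t }
  refine ⟨i, g, (LinearMap.surjective_or_eq_zero g).resolve_right fun hg => hi ?_⟩
  have mem : e i ∈ radPow e X i 0 := mem_radPow.2 ⟨1, by rw [pow_zero, mul_one, mul_one]⟩
  exact LinearMap.congr_fun hg ⟨e i, mem⟩

theorem globalDimension_le_iff (h : IsCyclicFrame K e X) {d : ℕ} (hd : d ≠ 0) :
    globalDimension A ≤ d ↔ ∀ i, ProjDimLT Aᵐᵒᵖ (radPow e X i 1) d := by
  simp only [globalDimension, iSup_le_iff, CategoryTheory.projectiveDimension_le_iff]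
  constructor
  · intro hle i
    let N := (radPow e X i 1).submoduleOf (radPow e X i 0)
    have := h.projective_radPow_zero i
    have : Module.Finite Aᵐᵒᵖ (radPow e X i 0) := Module.Finite.span_singleton _ _
    refine (ProjDimLT.succ_iff_of_surjective (radPow_antitone e X i zero_le_one)
      N.mkQ_surjective N.ker_mkQ hd).1 (hle (.of Aᵐᵒᵖ (radPow e X i 0 ⧸ N)) ?_)
    exact inferInstanceAs (Module.Finite Aᵐᵒᵖ (radPow e X i 0 ⧸ N))
  · intro hrad M hM
    have := h.moduleFinite
    have := IsArtinianRing.of_finite K Aᵐᵒᵖ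
    refine ProjDimLT.of_isFiniteLength (M := M) (fun T _ _ _ => ?_)
      (isFiniteLength_iff_isNoetherian_isArtinian.2 ⟨inferInstance, inferInstance⟩)
    obtain ⟨i, g, hg⟩ := h.exists_surjective_of_isSimpleModule T
    have := h.projective_radPow_zero i
    exact (ProjDimLT.succ_iff_of_surjective (radPow_antitone e X i zero_le_one) hg
      (h.eq_radPow_one_of_isCoatom (LinearMap.isCoatom_ker_of_surjective hg)) hd).2 (hrad i)

end GlobalDimension

end IsCyclicFrame

/-- A two-sided ideal as a submodule of the right regular module. -/
def toRightSubmodule {A : Type*} [Ring A] (H : TwoSidedIdeal A) : Submodule Aᵐᵒᵖ A where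
  carrier := H
  add_mem' := H.add_mem
  zero_mem' := H.zero_mem
  smul_mem' r _ hy := H.mul_mem_right _ r.unop hy

theorem idem_mul_mem_inf_radPow_zero {n : ℕ} {A : Type*} [Ring A] {e : ZMod n → A} {X : A}
    {H : TwoSidedIdeal A} {k : ZMod n} {y : A} (hy : y ∈ H) :
    e k * y ∈ toRightSubmodule H ⊓ radPow e X k 0 :=
  ⟨H.mul_mem_left _ _ hy, idem_mul_mem_radPow_zero⟩

/-- The shape of a Kupisch series `c` around a vertex `i` such that the ideal generated by `e_i` is
a nonzero heredity ideal: each `e_k A` either ends before `i` or ends in a copy of `e_i A`.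
For `k = i` and `d = n` this includes `c i ≤ n`. -/
def IsHeredityVertex {n : ℕ} (c : ZMod n → ℕ) (i : ZMod n) : Prop :=
  ∀ (k : ZMod n) (d : ℕ), k + d = i → c k ≤ d ∨ c k = d + c i

namespace IsCyclicFrame

section Heredity

variable {K : Type*} [Field K] {n : ℕ} [NeZero n] {A : Type*} [Ring A] [Algebra K A]
  {e : ZMod n → A} {X : A} {H : TwoSidedIdeal A} {i k : ZMod n} {l : ℕ}

theorem exists_inf_eq_radPow (h : IsCyclicFrame K e X) (H : TwoSidedIdeal A) (k : ZMod n) :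
    ∃ l ≤ kupischNumber e X k, toRightSubmodule H ⊓ radPow e X k 0 = radPow e X k l :=
  h.exists_eq_radPow inf_le_right

theorem projective_inf_radPow_zero (h : IsCyclicFrame K e X) [Module.Projective Aᵐᵒᵖ H]
    (k : ZMod n) :
    Module.Projective Aᵐᵒᵖ (toRightSubmodule H ⊓ radPow e X k 0 : Submodule Aᵐᵒᵖ A) := by
  let f : Module.End Aᵐᵒᵖ A := LinearMap.mulLeft Aᵐᵒᵖ (e k)
  have map_le : (toRightSubmodule H).map f ≤ toRightSubmodule H := by
    rintro _ ⟨y, hy, rfl⟩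
    exact H.mul_mem_left (e k) y hy
  have inf_eq : toRightSubmodule H ⊓ radPow e X k 0 = (toRightSubmodule H).map f :=
    le_antisymm (fun y hy => ⟨y, hy.1, h.idem_mul_of_mem_radPow hy.2⟩)
      (le_inf map_le fun _ ⟨y, _, hy⟩ => hy ▸ idem_mul_mem_radPow_zero)
  have : Module.Projective Aᵐᵒᵖ (toRightSubmodule H) := ‹Module.Projective Aᵐᵒᵖ H›
  rw [inf_eq]
  exact projective_map_of_isIdempotentElem (h.isIdempotentElem_mulLeft k) map_le

theorem idem_mem_of_inf_eq_radPow (h : IsCyclicFrame K e X)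
    (hH : H.asIdeal * H.asIdeal = H.asIdeal)
    (hk : toRightSubmodule H ⊓ radPow e X k 0 = radPow e X k l) (hl : l < kupischNumber e X k) :
    e (k + l) ∈ H := by
  by_contra hnot
  have mul_mem (b : A) (hb : b ∈ H) : e (k + l) * b ∈ radPow e X (k + l) 1 := by
    obtain ⟨m, -, hm⟩ := h.exists_inf_eq_radPow H (k + l)
    have hm0 : 1 ≤ m := by
      refine Nat.one_le_iff_ne_zero.2 fun hm0 => hnot ?_
      have mem : e (k + l) * X ^ 0 ∈ H := (hm.ge (hm0 ▸ mul_pow_mem_radPow le_rfl)).1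
      rwa [pow_zero, mul_one] at mem
    exact radPow_antitone e X _ hm0 (hm.le <| idem_mul_mem_inf_radPow_zero hb)
  have idem_mul_mem (y : A) (hy : y ∈ H.asIdeal * H.asIdeal) : e k * y ∈ radPow e X k (l + 1) := by
    induction hy using Submodule.mul_induction_on' with
    | mem_mul_mem a ha b hb =>
      rw [TwoSidedIdeal.mem_asIdeal] at ha hb
      obtain ⟨a', ha'⟩ := mem_radPow.1 (hk.le (idem_mul_mem_inf_radPow_zero ha))
      rw [← mul_assoc, ← ha', mul_assoc, ← h.idem_mul_pow_mul_idem, mul_assoc _ (e _)]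
      exact h.mul_mem_radPow_add (mul_mem _ (H.mul_mem_left _ _ hb))
    | add y _ z _ hy hz => exact mul_add (e k) y z ▸ add_mem hy hz
  have generator_mem : e k * X ^ l ∈ H := (hk.ge (mul_pow_mem_radPow le_rfl)).1
  have := idem_mul_mem _ (hH ▸ TwoSidedIdeal.mem_asIdeal.2 generator_mem)
  rw [← mul_assoc, h.idem, h.mul_pow_mem_radPow_iff] at this
  omega

theorem kupischNumber_le_of_idem_mem (h : IsCyclicFrame K e X)
    (hH : ∀ x ∈ H, ∀ j ∈ Ring.jacobson A, ∀ y ∈ H, x * j * y = 0) (hi : e i ∈ H)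
    (hil : e (i + l) ∈ H) (hl : l ≠ 0) : kupischNumber e X i ≤ l := by
  rw [← h.idem_mul_pow_eq_zero_iff, ← h.idem_mul_pow_mul_idem]
  exact hH _ hi _ (Ideal.pow_mem_of_mem _ h.X_mem_jacobson _ (Nat.pos_of_ne_zero hl)) _ hil

theorem exists_idem_mem (h : IsCyclicFrame K e X) (hH : H.asIdeal * H.asIdeal = H.asIdeal)
    (hne : H ≠ ⊥) : ∃ i, e i ∈ H := by
  obtain ⟨y, hy, hy0⟩ : ∃ y ∈ H, y ≠ 0 := by
    by_contra! hzero
    exact hne (eq_bot_iff.2 fun y hy => (TwoSidedIdeal.mem_bot A).2 (hzero y hy))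
  obtain ⟨k, hk⟩ := h.exists_idem_mul_ne_zero hy0
  obtain ⟨l, -, hl⟩ := h.exists_inf_eq_radPow H k
  refine ⟨_, h.idem_mem_of_inf_eq_radPow hH hl ?_⟩
  by_contra! hle
  have mem : e k * y ∈ radPow e X k l :=
    hl.le <| idem_mul_mem_inf_radPow_zero hy
  exact hk (by rwa [h.radPow_eq_bot hle, Submodule.mem_bot] at mem)

theorem exists_isHeredityVertex (h : IsCyclicFrame K e X) (hH : IsHeredityIdeal H) (hne : H ≠ ⊥) :
    ∃ i, IsHeredityVertex (kupischNumber e X) i := by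
  obtain ⟨i, hi⟩ := h.exists_idem_mem hH.idempotent hne
  refine ⟨i, fun k d hkd => ?_⟩
  have := hH.projective
  obtain ⟨l, hle, hl⟩ := h.exists_inf_eq_radPow H k
  have pow_mem : e k * X ^ d ∈ radPow e X k l := by
    refine hl ▸ ⟨?_, mul_pow_mem_radPow d.zero_le⟩
    rw [h.idem_mul_pow, hkd]
    exact H.mul_mem_left _ _ hi
  rw [h.mul_pow_mem_radPow_iff] at pow_mem
  rcases pow_mem with hld | hkd'
  swap
  · exact .inl hkd'
  rcases hle.eq_or_lt with rfl | hlt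
  · exact .inl hld
  have hmem := h.idem_mem_of_inf_eq_radPow hH.idempotent hl hlt
  have hproj := (h.projective_radPow_iff hlt).1 (hl ▸ h.projective_inf_radPow_zero k)
  have hle_add := h.kupischNumber_le_add k l
  obtain ⟨m, rfl⟩ := Nat.exists_eq_add_of_le hld
  rw [Nat.cast_add, ← add_assoc] at hkd
  rcases eq_or_ne m 0 with rfl | hm
  · rw [Nat.cast_zero, add_zero] at hkd
    rw [← hkd]
    exact .inr (by omega)
  · have := h.kupischNumber_le_of_idem_mem hH.mul_jacobson_mul hmem (hkd ▸ hi) hm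
    exact .inl (by omega)

end Heredity

end IsCyclicFrame

theorem exists_add_natCast_eq {n : ℕ} [NeZero n] (j i : ZMod n) :
    ∃ d : ℕ, 1 ≤ d ∧ d ≤ n ∧ j + d = i :=
  ⟨(i - j - 1).val + 1, Nat.le_add_left _ _, ZMod.val_lt _, by
    rw [Nat.cast_succ, ZMod.natCast_zmod_val]; ring⟩

namespace IsHeredityVertex

variable {n : ℕ} [NeZero n] {c : ZMod n → ℕ} {i : ZMod n}

theorem apply_le (hi : IsHeredityVertex c i) : c i ≤ n := by
  have := hi i n (by rw [ZMod.natCast_self, add_zero])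
  have := NeZero.ne n
  omega

theorem exists_three_le (hi : IsHeredityVertex c i) (hc : ∀ k, 2 ≤ c k)
    (hne : ¬ ∃ b, c b = 3 ∧ ∀ k ≠ b, c k = 2) : ∃ s : ℕ, s + 2 ≤ n ∧ 3 ≤ c (i + s) := by
  by_contra! hlt
  have eq_two (s : ℕ) (hs : s + 2 ≤ n) : c (i + s) = 2 :=
    le_antisymm (Nat.le_of_lt_succ (hlt s hs)) (hc _)
  have two_le := (hc i).trans hi.apply_le
  refine hne ⟨i - 1, ?_, fun k hk => ?_⟩
  · have hi_two : c i = 2 := by simpa only [Nat.cast_zero, add_zero] using eq_two 0 (by omega)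
    have := hi (i - 1) 1 (by rw [Nat.cast_one, sub_add_cancel])
    have := hc (i - 1)
    omega
  · obtain ⟨d, hd, hdn, rfl⟩ := exists_add_natCast_eq (i - 1) k
    obtain ⟨s, rfl⟩ := Nat.exists_eq_add_of_le' hd
    have hsn : s + 1 ≠ n := fun hsn => hk (by rw [hsn, ZMod.natCast_self, add_zero])
    have := eq_two s (by omega)
    rwa [show i + (s : ZMod n) = i - 1 + (s + 1 : ℕ) by push_cast; ring] at this

end IsHeredityVertex

namespace IsCyclicFrame

section HeredityVertex

variable {K : Type*} [Field K] {n : ℕ} [NeZero n] {A : Type v} [Ring A] [Algebra K A]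
  {e : ZMod n → A} {X : A} {i k : ZMod n} {d l : ℕ}

theorem projDimLT_one_of_eq_add (h : IsCyclicFrame K e X)
    (hi : IsHeredityVertex (kupischNumber e X) i) (hkd : k + d = i)
    (hk : kupischNumber e X k = d + kupischNumber e X i) (hl : l ≤ d) :
    ProjDimLT Aᵐᵒᵖ (radPow e X k l) 1 := by
  have := h.two_le_kupischNumber i
  rw [ProjDimLT.one_iff, h.projective_radPow_iff (by omega)]
  have := hi (k + l) (d - l) (by rw [add_assoc, ← Nat.cast_add, Nat.add_sub_cancel' hl, hkd])
  omega

theorem projDimLT_radPow (h : IsCyclicFrame K e X) (hi : IsHeredityVertex (kupischNumber e X) i)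
    (hkd : k + d = i) (hl : 1 ≤ l) (hld : l ≤ d) :
    ProjDimLT Aᵐᵒᵖ (radPow e X k l) (d - l + 1) := by
  induction d using Nat.strong_induction_on generalizing k l with
  | _ d ih =>
    rcases le_or_gt (kupischNumber e X k) l with hkl | hkl
    · rw [h.radPow_eq_bot hkl]
      exact .of_subsingleton _
    rcases hi k d hkd with hk | hk
    · have hkl_add : k + l + (d - l : ℕ) = i := by
        rw [add_assoc, ← Nat.cast_add, Nat.add_sub_cancel' hld, hkd]
      refine (h.projDimLT_succ_iff k l (by omega)).2 (.mono ?_ (ih (d - l) ?_ hkl_add ?_ ?_)) <;>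
        omega
    · exact .mono (by omega) (h.projDimLT_one_of_eq_add hi hkd hk hld)

theorem globalDimension_le (h : IsCyclicFrame K e X)
    (hi : IsHeredityVertex (kupischNumber e X) i) : globalDimension A ≤ n := by
  refine (h.globalDimension_le_iff (NeZero.ne n)).2 fun j => ?_
  obtain ⟨d, hd, hdn, hjd⟩ := exists_add_natCast_eq j i
  exact .mono (by omega) (h.projDimLT_radPow hi hjd le_rfl hd)

theorem projDimLT_radPow_one_of_three_le_kupischNumber (h : IsCyclicFrame K e X)
    (hi : IsHeredityVertex (kupischNumber e X) i) (hkd : k + d = i) (hd : 2 ≤ d)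
    (hk : 3 ≤ kupischNumber e X k) : ProjDimLT Aᵐᵒᵖ (radPow e X k 1) (d - 1) := by
  rcases hi k d hkd with hle | heq
  · obtain ⟨d, rfl⟩ := Nat.exists_eq_add_of_le' hd
    refine (h.projDimLT_succ_iff k 1 (by omega)).2
      (.mono ?_ (h.projDimLT_radPow (d := d + 1) hi ?_ ?_ ?_))
    · omega
    · rw [← hkd]; push_cast; ring
    all_goals omega
  · exact .mono (by omega) (h.projDimLT_one_of_eq_add hi hkd heq (by omega))

theorem projDimLT_radPow_one_of_three_le_kupischNumber_add (h : IsCyclicFrame K e X)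
    (hi : IsHeredityVertex (kupischNumber e X) i) (hkd : k + d = i) {s : ℕ} (hsd : s + 2 ≤ d)
    (hs : 3 ≤ kupischNumber e X (k + s)) : ProjDimLT Aᵐᵒᵖ (radPow e X k 1) (d - 1) := by
  induction s generalizing k d with
  | zero =>
    rw [Nat.cast_zero, add_zero] at hs
    exact h.projDimLT_radPow_one_of_three_le_kupischNumber hi hkd hsd hs
  | succ s ih =>
    rcases (h.two_le_kupischNumber k).lt_or_eq with hk | hk
    · exact h.projDimLT_radPow_one_of_three_le_kupischNumber hi hkd (by omega) hk
    · obtain ⟨d, rfl⟩ := Nat.exists_eq_add_of_le' (by omega : 2 ≤ d)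
      refine (h.projDimLT_succ_iff k 1 (by omega)).2 ?_
      rw [← hk]
      refine ih (d := d + 1) ?_ (by omega) ?_
      · rw [← hkd]; push_cast; ring
      · rwa [show k + (1 : ℕ) + (s : ZMod n) = k + (s + 1 : ℕ) by push_cast; ring]

theorem globalDimension_le_sub_one (h : IsCyclicFrame K e X)
    (hi : IsHeredityVertex (kupischNumber e X) i)
    (hne : ¬ ∃ b, kupischNumber e X b = 3 ∧ ∀ k ≠ b, kupischNumber e X k = 2) :
    globalDimension A ≤ (n - 1 : ℕ) := by
  obtain ⟨s, hsn, hs⟩ := hi.exists_three_le h.two_le_kupischNumber hne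
  refine (h.globalDimension_le_iff (by omega)).2 fun j => ?_
  obtain ⟨d, hd, hdn, hjd⟩ := exists_add_natCast_eq j i
  rcases hdn.lt_or_eq with hlt | rfl
  · exact .mono (by omega) (h.projDimLT_radPow hi hjd le_rfl hd)
  · obtain rfl : j = i := by rw [← hjd, ZMod.natCast_self, add_zero]
    exact h.projDimLT_radPow_one_of_three_le_kupischNumber_add hi hjd hsn hs

theorem not_projDimLT_radPow_one (h : IsCyclicFrame K e X) {b : ZMod n}
    (hb : kupischNumber e X b = 3) (hne : ∀ k ≠ b, kupischNumber e X k = 2) (hd : 1 ≤ d)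
    (hdn : d < n) (hkd : k + d = b) : ¬ ProjDimLT Aᵐᵒᵖ (radPow e X k 1) d := by
  have eq_two {k : ZMod n} {d : ℕ} (hd : 1 ≤ d) (hdn : d < n) (hkd : k + d = b) :
      kupischNumber e X k = 2 := by
    refine hne k fun hkb => ?_
    rw [hkb, add_eq_left, ZMod.natCast_eq_zero_iff] at hkd
    exact (Nat.le_of_dvd hd hkd).not_gt hdn
  induction d, hd using Nat.le_induction generalizing k with
  | base =>
    have := eq_two le_rfl hdn hkd
    rw [ProjDimLT.one_iff, h.projective_radPow_iff (by omega), hkd]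
    omega
  | succ d hd ih =>
    rw [h.projDimLT_succ_iff k 1 (by omega), eq_two (Nat.le_add_left 1 d) hdn hkd]
    exact ih (by omega) (by rw [← hkd]; push_cast; ring)

theorem not_globalDimension_le_sub_one (h : IsCyclicFrame K e X) (hn : 2 ≤ n)
    (hb : ∃ b, kupischNumber e X b = 3 ∧ ∀ k ≠ b, kupischNumber e X k = 2) :
    ¬ globalDimension A ≤ (n - 1 : ℕ) := by
  obtain ⟨b, hb, hne⟩ := hb
  rw [h.globalDimension_le_iff (by omega)]
  exact fun hle => h.not_projDimLT_radPow_one hb hne (by omega) (by omega) (sub_add_cancel b _)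
    (hle (b - (n - 1 : ℕ)))

end HeredityVertex

end IsCyclicFrame

section Rotation

variable {n : ℕ} [NeZero n] {α : Type*}

theorem isRotated_ofFn_iff {c c' : ZMod n → α} :
    (List.ofFn fun i : Fin n => c (i : ℕ)).IsRotated (List.ofFn fun i : Fin n => c' (i : ℕ)) ↔
      ∃ k, ∀ i, c (i + k) = c' i := by
  have rotate_eq_iff (k : ℕ) : (List.ofFn fun i : Fin n => c (i : ℕ)).rotate k =
      (List.ofFn fun i : Fin n => c' (i : ℕ)) ↔ ∀ i, c (i + k) = c' i := by
    simp only [List.ext_getElem_iff, List.length_rotate, List.length_ofFn, List.getElem_rotate,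
      List.getElem_ofFn, ZMod.natCast_mod, Nat.cast_add, true_and]
    refine ⟨fun h i => ?_, fun h i _ _ => h i⟩
    simpa only [ZMod.natCast_zmod_val] using h i.val i.val_lt i.val_lt
  exact ⟨fun ⟨k, hk⟩ => ⟨k, (rotate_eq_iff k).1 hk⟩, fun ⟨k, hk⟩ =>
    ⟨k.val, (rotate_eq_iff _).2 (by rwa [ZMod.natCast_zmod_val])⟩⟩

theorem replicate_append_singleton_eq_ofFn (x y : α) :
    List.replicate (n - 1) x ++ [y] =
      List.ofFn fun i : Fin n => Function.update (fun _ : ZMod n => x) (-1) y (i : ℕ) := by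
  classical
  obtain ⟨m, rfl⟩ := Nat.exists_eq_succ_of_ne_zero (NeZero.ne n)
  have last : ((m : ℕ) : ZMod (m + 1)) = -1 := by
    rw [eq_neg_iff_add_eq_zero, ← Nat.cast_succ, ZMod.natCast_self]
  have castSucc_ne (i : Fin m) : ((i : ℕ) : ZMod (m + 1)) ≠ -1 := by
    rw [← last, Ne, ZMod.natCast_eq_natCast_iff', Nat.mod_eq_of_lt (by omega),
      Nat.mod_eq_of_lt (by omega)]
    exact i.2.ne
  rw [List.ofFn_succ', List.concat_eq_append, Fin.val_last, last, Function.update_self]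
  simp only [Fin.val_castSucc, Function.update_of_ne (castSucc_ne _), List.ofFn_const,
    Nat.succ_sub_one]

theorem isRotated_replicate_append_singleton_iff {c : ZMod n → α} {x y : α} :
    (List.ofFn fun i : Fin n => c (i : ℕ)).IsRotated (List.replicate (n - 1) x ++ [y]) ↔
      ∃ b, c b = y ∧ ∀ k ≠ b, c k = x := by
  rw [replicate_append_singleton_eq_ofFn, isRotated_ofFn_iff]
  refine Equiv.exists_congr (Equiv.subRight 1) fun k => ?_
  rw [← funext_iff (f := fun i => c (i + k)), Function.eq_update_iff, Equiv.subRight_apply,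
    neg_add_eq_sub]
  refine and_congr_right' (Equiv.forall_congr (Equiv.addRight k) fun i => ?_)
  rw [Equiv.coe_addRight, Ne, Ne, ← eq_sub_iff_add_eq, sub_sub_cancel_left]

end Rotation

namespace PathAlgebra

variable {K V : Type*} [Field K] [Quiver V]

theorem completeOrthogonalIdempotents_idem [Fintype V] :
    CompleteOrthogonalIdempotents (idem K : V → PathAlgebra K V) where
  idem _ := ofPath_mul_ofPath Quiver.Path.nil Quiver.Path.nil
  ortho _ _ hij := ofPath_mul_ofPath_of_ne Quiver.Path.nil Quiver.Path.nil hij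
  complete := one_def.symm

theorem span_range_ofPath :
    Submodule.span K (Set.range fun p : Σ i j : V, Quiver.Path i j => ofPath K p.2.2) = ⊤ := by
  have := (Finsupp.basisSingleOne (R := K) (ι := Σ i j : V, Quiver.Path i j)).span_eq
  rw [Finsupp.coe_basisSingleOne] at this
  exact this

theorem ofPath_notMem_arrowIdealPow {i j : V}
    (p : Quiver.Path i j) {m : ℕ} (hm : p.length < m) : ofPath K p ∉ arrowIdealPow K V m := by
  let coeff : PathAlgebra K V →ₗ[K] K :=
    (Finsupp.lapply ⟨i, j, p⟩ : ((Σ i j : V, Quiver.Path i j) →₀ K) →ₗ[K] K)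
  have le_ker : arrowIdealPow K V m ≤ LinearMap.ker coeff := by
    refine Submodule.span_le.2 ?_
    rintro _ ⟨k, l, q, hq, rfl⟩
    refine Finsupp.single_eq_of_ne fun heq => ?_
    have : p.length = q.length :=
      congrArg (fun x : Σ i j : V, Quiver.Path i j => x.2.2.length) heq
    omega
  have coeff_eq_one : coeff (ofPath K p) = 1 := Finsupp.single_eq_same
  exact fun hp => one_ne_zero (coeff_eq_one.symm.trans (le_ker hp))

end PathAlgebra

namespace CyclicQuiver

open PathAlgebra

variable {K : Type*} [Field K] {n : ℕ}

/-- The identification of the integers modulo `n` with the vertices of the oriented cycle. -/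
def vertex : ZMod n ≃ CyclicQuiver n :=
  Equiv.refl _

/-- The vertex `i + 1`. -/
def next (i : CyclicQuiver n) : CyclicQuiver n :=
  vertex (vertex.symm i + 1)

/-- The arrow `i → i + 1`. -/
def arrow (i : CyclicQuiver n) : i ⟶ next i :=
  ⟨rfl⟩

theorem next_injective : Function.Injective (next (n := n)) :=
  vertex.injective.comp ((add_left_injective 1).comp vertex.symm.injective)

theorem exists_path_length_eq (i : CyclicQuiver n) (l : ℕ) :
    ∃ (j : CyclicQuiver n) (p : Quiver.Path i j), p.length = l := by
  induction l with
  | zero => exact ⟨i, Quiver.Path.nil, rfl⟩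
  | succ l ih =>
    obtain ⟨j, p, hp⟩ := ih
    exact ⟨_, p.cons (arrow j), by rw [Quiver.Path.length_cons, hp]⟩

/-- The sum of all arrows of the oriented cycle, whose multiples by trivial paths are the arrows. -/
noncomputable def arrowSum (K : Type*) [Field K] (n : ℕ) [NeZero n] :
    PathAlgebra K (CyclicQuiver n) :=
  ∑ i : CyclicQuiver n, ofPath K (arrow i).toPath

variable [NeZero n]

theorem ofPath_mul_arrowSum {i j : CyclicQuiver n} (p : Quiver.Path i j) :
    ofPath K p * arrowSum K n = ofPath K (p.cons (arrow j)) := by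
  rw [arrowSum, Finset.mul_sum, Fintype.sum_eq_single j fun k hk =>
    ofPath_mul_ofPath_of_ne _ _ hk.symm]
  exact ofPath_mul_ofPath p (arrow j).toPath

theorem idem_mul_arrowSum (i : CyclicQuiver n) :
    idem K i * arrowSum K n = ofPath K (arrow i).toPath :=
  ofPath_mul_arrowSum Quiver.Path.nil

theorem arrowSum_mul_idem_next (i : CyclicQuiver n) :
    arrowSum K n * idem K (next i) = ofPath K (arrow i).toPath := by
  rw [arrowSum, Finset.sum_mul, idem, Fintype.sum_eq_single i fun k hk =>
    ofPath_mul_ofPath_of_ne (arrow k).toPath Quiver.Path.nil (next_injective.ne hk)]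
  exact ofPath_mul_ofPath (arrow i).toPath Quiver.Path.nil

theorem ofPath_eq_idem_mul_arrowSum_pow {i j : CyclicQuiver n} (p : Quiver.Path i j) :
    ofPath K p = idem K i * arrowSum K n ^ p.length := by
  induction p with
  | nil => rw [Quiver.Path.length_nil, pow_zero, mul_one]; rfl
  | @cons b c p a ih =>
    obtain rfl : c = next b := a.down
    rw [Quiver.Path.length_cons, pow_succ, ← mul_assoc, ← ih, ofPath_mul_arrowSum]
    rfl

theorem arrowSum_pow_mem_arrowIdealPow (m : ℕ) :
    arrowSum K n ^ m ∈ arrowIdealPow K (CyclicQuiver n) m := by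
  rw [← one_mul (arrowSum K n ^ m), one_def, Finset.sum_mul]
  refine Submodule.sum_mem _ fun i _ => ?_
  obtain ⟨j, p, rfl⟩ := exists_path_length_eq i m
  rw [← ofPath_eq_idem_mul_arrowSum_pow]
  exact Submodule.subset_span ⟨i, j, p, le_rfl, rfl⟩

end CyclicQuiver

namespace IsBoundQuiverPresentation

open CyclicQuiver PathAlgebra

section CyclicNakayama

variable {K : Type*} [Field K] {n : ℕ} [NeZero n] {A : Type*} [Ring A] [Algebra K A]
  {φ : PathAlgebra K (CyclicQuiver n) →ₐ[K] A}

theorem isCyclicFrame (hφ : IsBoundQuiverPresentation φ) :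
    IsCyclicFrame K (fun i => φ (idem K (vertex i))) (φ (arrowSum K n)) where
  toCompleteOrthogonalIdempotents :=
    (CompleteOrthogonalIdempotents.equiv vertex).2
      (completeOrthogonalIdempotents_idem.map φ.toRingHom)
  idem_mul_X i := by
    rw [← map_mul, ← map_mul, idem_mul_arrowSum]
    exact congrArg φ (arrowSum_mul_idem_next (vertex i)).symm
  isNilpotent := by
    obtain ⟨N, -, hN⟩ := hφ.exists_arrowIdealPow_le
    exact ⟨N, (map_pow φ _ N).symm.trans (hN (arrowSum_pow_mem_arrowIdealPow N))⟩
  mem_span a := by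
    obtain ⟨x, rfl⟩ := hφ.surjective a
    have := Submodule.apply_mem_span_image_of_mem_span φ.toLinearMap
      (span_range_ofPath (K := K).ge (Submodule.mem_top (x := x)))
    refine Submodule.span_mono ?_ this
    rintro _ ⟨_, ⟨⟨i, j, p⟩, rfl⟩, rfl⟩
    exact ⟨(vertex.symm i, p.length), by simp [ofPath_eq_idem_mul_arrowSum_pow]⟩
  idem_mul_X_ne_zero i := by
    rw [← map_mul, idem_mul_arrowSum]
    exact fun hzero => ofPath_notMem_arrowIdealPow (arrow (vertex i)).toPath
      Nat.one_lt_two (hφ.le_arrowIdealPow_two hzero)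

theorem kupischSeries_eq_ofFn (hφ : IsBoundQuiverPresentation φ) :
    kupischSeries φ = List.ofFn fun i : Fin n =>
      kupischNumber (fun j => φ (idem K (vertex j))) (φ (arrowSum K n)) (i : ℕ) :=
  congrArg List.ofFn (funext fun i => hφ.isCyclicFrame.finrank_range_mulLeft (i : ℕ))

end CyclicNakayama

end IsBoundQuiverPresentation

namespace IsHeredityIdeal

variable {A B : Type*} [Ring A] [Ring B] {J : TwoSidedIdeal B}

theorem comap (hJ : IsHeredityIdeal J) (f : A ≃+* B) : IsHeredityIdeal (J.comap f) where
  idempotent := by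
    refine le_antisymm Ideal.mul_le_right fun x hx => ?_
    have symm_mem (y : B) (hy : y ∈ J.asIdeal * J.asIdeal) :
        f.symm y ∈ (J.comap f).asIdeal * (J.comap f).asIdeal := by
      have symm_mem_comap {b : B} (hb : b ∈ J.asIdeal) : f.symm b ∈ (J.comap f).asIdeal := by
        rwa [TwoSidedIdeal.mem_asIdeal, TwoSidedIdeal.mem_comap, f.apply_symm_apply]
      induction hy using Submodule.mul_induction_on' with
      | mem_mul_mem a ha b hb =>
        rw [map_mul]
        exact Ideal.mul_mem_mul (symm_mem_comap ha) (symm_mem_comap hb)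
      | add y _ z _ hy hz => exact map_add f.symm y z ▸ add_mem hy hz
    rw [TwoSidedIdeal.mem_asIdeal, TwoSidedIdeal.mem_comap, ← TwoSidedIdeal.mem_asIdeal,
      ← hJ.idempotent] at hx
    simpa only [f.symm_apply_apply] using symm_mem _ hx
  mul_jacobson_mul x hx j hj y hy := by
    rw [TwoSidedIdeal.mem_comap] at hx hy
    refine f.injective ?_
    rw [map_mul, map_mul, map_zero]
    exact hJ.mul_jacobson_mul _ hx _ (Ring.le_comap_jacobson (f : A →+* B) hj) _ hy
  projective := by
    have := hJ.projective
    let σ : Bᵐᵒᵖ ≃+* Aᵐᵒᵖ := f.symm.op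
    have := RingHomInvPair.of_ringEquiv σ
    have := RingHomInvPair.of_ringEquiv σ.symm
    let g : J ≃ₛₗ[(σ : Bᵐᵒᵖ →+* Aᵐᵒᵖ)] J.comap f :=
      { toFun := fun y => ⟨f.symm y, by simp [TwoSidedIdeal.mem_comap]⟩
        invFun := fun x => ⟨f x, (TwoSidedIdeal.mem_comap f).1 x.2⟩
        left_inv := fun y => by simp
        right_inv := fun x => by simp
        map_add' := fun x y => Subtype.ext (map_add f.symm _ _)
        map_smul' := fun r y => Subtype.ext (map_mul f.symm _ _) }
    exact .of_equiv g

end IsHeredityIdeal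

theorem IsQuasiHereditary.exists_isHeredityIdeal {A : Type*} [Ring A] [Nontrivial A]
    (hA : IsQuasiHereditary A) : ∃ H : TwoSidedIdeal A, IsHeredityIdeal H ∧ H ≠ ⊥ := by
  obtain ⟨m, I, hI, hbot, htop, hH⟩ := hA
  have hm : m ≠ 0 := by
    rintro rfl
    exact bot_ne_top (hbot.symm.trans htop)
  obtain ⟨m, rfl⟩ := Nat.exists_eq_succ_of_ne_zero hm
  have injective : Function.Injective (I 0).ringCon.mk' := by
    rw [← TwoSidedIdeal.ker_eq_bot, TwoSidedIdeal.ker_ringCon_mk', hbot]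
  let f := RingEquiv.ofBijective _ ⟨injective, RingCon.mk'_surjective _⟩
  refine ⟨_, (hH 0).comap f, fun hcomap => (hI (Fin.succ_pos 0)).not_ge fun x hx => ?_⟩
  have mem : x ∈ ((I (Fin.succ 0)).map (I 0).ringCon.mk').comap f :=
    (TwoSidedIdeal.mem_comap f).2 (TwoSidedIdeal.subset_span ⟨x, hx, rfl⟩)
  rw [hbot]
  exact hcomap ▸ mem

theorem mainTheorem10_general {K : Type*} [Field K] {n : ℕ} [NeZero n] {A : Type v} [Ring A]
    [Algebra K A] (φ : PathAlgebra K (CyclicQuiver n) →ₐ[K] A) (hφ : IsBoundQuiverPresentation φ)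
    {H : TwoSidedIdeal A} (hH : IsHeredityIdeal H) (hne : H ≠ ⊥) :
    (globalDimension A = (n : WithBot ℕ∞) ↔
      (kupischSeries φ).IsRotated (List.replicate (n - 1) 2 ++ [3])) ∧
    (¬ (kupischSeries φ).IsRotated (List.replicate (n - 1) 2 ++ [3]) →
      globalDimension A ≤ ((n - 1 : ℕ) : WithBot ℕ∞)) := by
  have h := hφ.isCyclicFrame
  obtain ⟨i, hi⟩ := h.exists_isHeredityVertex hH hne
  have two_le : 2 ≤ n := (h.two_le_kupischNumber i).trans hi.apply_le
  rw [hφ.kupischSeries_eq_ofFn, isRotated_replicate_append_singleton_iff]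
  refine ⟨⟨fun hn => ?_, fun hc => ?_⟩, h.globalDimension_le_sub_one hi⟩
  · by_contra hc
    have : n ≤ n - 1 := by exact_mod_cast hn ▸ h.globalDimension_le_sub_one hi hc
    omega
  · refine (h.globalDimension_le hi).antisymm ?_
    have cast_sub_add_one : ((n - 1 : ℕ) : WithBot ℕ∞) + 1 = n := by
      exact_mod_cast Nat.sub_add_cancel (Nat.one_le_of_lt two_le)
    rw [← cast_sub_add_one, ENat.WithBot.add_one_le_iff, ← not_le]
    exact h.not_globalDimension_le_sub_one two_le hc

theorem mainTheorem10 {K : Type u} [Field K] {n : ℕ} [NeZero n] {A : Type v} [Ring A] [Algebra K A]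
    (φ : PathAlgebra K (CyclicQuiver n) →ₐ[K] A) (hφ : IsBoundQuiverPresentation φ)
    (hA : IsQuasiHereditary A) :
    (globalDimension A = (n : WithBot ℕ∞) ↔
      (kupischSeries φ).IsRotated (List.replicate (n - 1) 2 ++ [3])) ∧
    (¬ (kupischSeries φ).IsRotated (List.replicate (n - 1) 2 ++ [3]) →
      globalDimension A ≤ ((n - 1 : ℕ) : WithBot ℕ∞)) :=
  have := hφ.isCyclicFrame.nontrivial
  have ⟨_, hH, hne⟩ := hA.exists_isHeredityIdeal
  mainTheorem10_general φ hφ hH hne
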